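/- Let $n\ge 1$ and let $\mathbf y=(y_1,\dots,y_n)$ be a vector of non-negative integers such that $y_i\ge n-1$ for all $i$ and $y_1\ge n$. Let $\Pi_n(\mathbf y)=\{\mathbf x\in\mathbb R_{\ge 0}^n : \sum_{i=1}^k x_i\le \sum_{i=1}^k y_i \text{ for } k=1,\dots,n\}$ be the Pitman--Stanley polytope, and let $\operatorname{ehr}_{\Pi_n(\mathbf y)}$ be its Ehrhart polynomial, that is, the unique real polynomial with $\operatorname{ehr}_{\Pi_n(\mathbf y)}(t)=|t\,\Pi_n(\mathbf y)\cap\mathbb Z^n|$ for every positive integer $t$. It exists and has degree $n$. Its magic coefficients are the unique real numbers $c_0,\dots,c_n$ with $$\operatorname{ehr}_{\Pi_n(\mathbf y)}(t)=\sum_{j=0}^n c_j\,t^j(1+t)^{n-j}.$$ A $\mathbf y$-parking function is a sequence $\sigma=(\sigma_1,\dots,\sigma_n)$ of positive integers whose weakly increasing rearrangement $b_1\le\cdots\le b_n$ satisfies $b_i\le y_1+\cdots+y_i$ for all $i$. In the block parking protocol the spaces $1,\dots,y_1+\cdots+y_n$ are divided into $n$ circles, the $i$-th one consisting of the spaces of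 $Y_i=\{y_1+\cdots+y_{i-1}+1,\dots,y_1+\cdots+y_i\}$ in cyclic order, and the first space of $Y_1$ is permanently unavailable. Cars $1,\dots,n$ arrive in order. Car $j$, with preference $\sigma_j\in Y_i$, goes to the space $\sigma_j$; if that space is occupied or unavailable, the car advances cyclically within $Y_i$ and parks in the first available space that it meets; if there is none, it leaves without parking. Car $j$ is lucky if it parks in the space $\sigma_j$. Then for every $0\le j\le n$, the number $n!\,c_j$ equals the number of $\mathbf y$-parking functions with exactly $j$ lucky cars under the block parking protocol with the first space unavailable. -/

import Mathlib

open scoped Pointwise Nat Polynomial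

namespace PitmanStanley

/-! ### Lattice polytopes and their Ehrhart polynomials -/

/-- The Pitman-Stanley polytope of `y = (y_1, …, y_n)`: all `x ≥ 0` in `ℝⁿ` such that
`x_1 + ⋯ + x_k ≤ y_1 + ⋯ + y_k` for every `k = 1, …, n`. -/
def polytope {n : ℕ} (y : Fin n → ℕ) : Set (Fin n → ℝ) :=
  {x | (∀ i, 0 ≤ x i) ∧
    ∀ k : Fin n, ∑ i ∈ Finset.Iic k, x i ≤ ∑ i ∈ Finset.Iic k, (y i : ℝ)}

/-- The number of points of `P ∩ ℤⁿ` (used only for bounded `P`). -/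
noncomputable def latticePointCount {n : ℕ} (P : Set (Fin n → ℝ)) : ℕ :=
  Set.ncard {z : Fin n → ℤ | (fun i => (z i : ℝ)) ∈ P}

/-- `p` is the Ehrhart polynomial of `P`: for every positive integer `t`, the value `p(t)` is the
number of lattice points in the dilate `t P`. -/
def IsEhrhartPolynomial {n : ℕ} (P : Set (Fin n → ℝ)) (p : ℝ[X]) : Prop :=
  ∀ t : ℕ, 0 < t → p.eval (t : ℝ) = latticePointCount ((t : ℝ) • P)

/-- `c_0, …, c_d` are the coefficients of `p` in the basis `t^j (1+t)^(d-j)`, `0 ≤ j ≤ d`. -/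
def IsMagicExpansion (d : ℕ) (p : ℝ[X]) (c : Fin (d + 1) → ℝ) : Prop :=
  p = ∑ j : Fin (d + 1),
    Polynomial.C (c j) * (Polynomial.X ^ (j : ℕ) * (1 + Polynomial.X) ^ (d - (j : ℕ)))

/-! ### Parking functions -/

/-- `σ = (σ_1, …, σ_n)` is a `y`-parking function: its entries are positive integers and their
weakly increasing rearrangement `b_1 ≤ ⋯ ≤ b_n` satisfies `b_i ≤ y_1 + ⋯ + y_i` for all `i`. -/
def IsParkingFunction {n : ℕ} (y : Fin n → ℕ) (σ : Fin n → ℕ) : Prop :=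
  (∀ j, 0 < σ j) ∧ ∀ i : Fin n, (σ ∘ Tuple.sort σ) i ≤ ∑ k ∈ Finset.Iic i, y k

/-! ### The block parking protocol

The spaces are labelled `1, …, y_1 + ⋯ + y_n`; they are split into consecutive blocks
`Y_1, …, Y_n` with `|Y_i| = y_i`, and each block is a circle. -/

/-- `y_1 + ⋯ + y_{i-1}`, the number of spaces before the block `Y_i`. -/
def blockStart {n : ℕ} (y : Fin n → ℕ) (i : Fin n) : ℕ := ∑ k ∈ Finset.Iio i, y k

/-- The block `Y_i = {y_1 + ⋯ + y_{i-1} + 1, …, y_1 + ⋯ + y_i}`. -/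
def block {n : ℕ} (y : Fin n → ℕ) (i : Fin n) : Finset ℕ :=
  Finset.Ioc (blockStart y i) (blockStart y i + y i)

/-- The space that follows `s` in the cyclic order of the block `Y_i`. -/
def advance {n : ℕ} (y : Fin n → ℕ) (i : Fin n) (s : ℕ) : ℕ :=
  if s = blockStart y i + y i then blockStart y i + 1 else s + 1

/-- Where a car with preference `w` parks when the spaces in `O` are occupied or unavailable.
If `w ∈ Y_i`, the car tries `w` and then advances cyclically, once around the block, and takes the
first space that is not in `O`; `none` means that the car cannot park. -/
def park {n : ℕ} (y : Fin n → ℕ) (O : Finset ℕ) (w : ℕ) : Option ℕ :=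
  ((List.finRange n).find? fun i => w ∈ block y i).bind fun i =>
    ((List.range (y i)).map fun k => (advance y i)^[k] w).find? fun s => s ∉ O

/-- The permanently unavailable space: the first position of the block `Y_l`
if `l` is a block, and no space at all if `l = none`. -/
def unavailable {n : ℕ} (y : Fin n → ℕ) : Option (Fin n) → Finset ℕ
  | none => ∅
  | some l => {s ∈ block y l | s = blockStart y l + 1}

/-- The spaces that are unavailable or occupied after the first `j` of the `r` cars with preferences
`w_1, …, w_r` have tried to park. -/
def occupied {n r : ℕ} (y : Fin n → ℕ) (l : Option (Fin n)) (w : Fin r → ℕ) : ℕ → Finset ℕ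
  | 0 => unavailable y l
  | j + 1 =>
    if h : j < r then
      occupied y l w j ∪ (park y (occupied y l w j) (w ⟨j, h⟩)).toFinset
    else occupied y l w j

/-- The outcome of the block parking protocol: the space where the `j`-th car parks, or `none` if it
fails to park. -/
def outcome {n r : ℕ} (y : Fin n → ℕ) (l : Option (Fin n)) (w : Fin r → ℕ) (j : Fin r) :
    Option ℕ :=
  park y (occupied y l w j) (w j)

/-- The set of lucky cars: those that park in their preferred space. -/
def luckyCars {n r : ℕ} (y : Fin n → ℕ) (l : Option (Fin n)) (w : Fin r → ℕ) : Finset (Fin r) :=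
  {j | outcome y l w j = some (w j)}

/-- The number of `y`-parking functions with exactly `j` lucky cars under the block parking
protocol with parameter `l`. -/
noncomputable def luckyCount {n : ℕ} (y : Fin n → ℕ) (l : Option (Fin n)) (j : ℕ) : ℕ :=
  Set.ncard {σ : Fin n → ℕ | IsParkingFunction y σ ∧ (luckyCars y l σ).card = j}

end PitmanStanley

namespace PitmanStanley

/-! ### Multichoose identities -/

/-! Both sides are the same sum of products of rising factorials over assignments of cars to blocks.

On the polytope side, `card_boundedVectors` sums out one coordinate at a time by hockey-stick and
Vandermonde identities for `multichoose`. The number of lattice points is the sum, over ballot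
vectors `k`, of the products of `(y_i + [i = 1]).multichoose k_i`. The factor `n!` turns each term
into a multinomial coefficient, which counts the maps `β` from cars to blocks with fibre sizes `k`,
times rising factorials of length `k_i` (`factorial_mul_card_boundedVectors`).

On the parking side, being a parking function depends only on the preferred blocks: their fibre
sizes must be a ballot vector (`isParkingFunction_iff`). Fix `β` and weight lucky cars by `t`, the
others by `1 + t`. A car whose block has `m` spaces taken contributes `(y_i - m) t + m (1 + t) = t
y_i + m`, wherever these spaces lie, so each block yields a rising factorial of `t y_i + [i = 1]`
(`sum_prod_lucky`). The unavailable space accounts for `[i = 1]`.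

The two sides thus agree at every natural `t`. Polynomial identity and independence of the magic
basis finish the proof. -/

theorem sum_antidiagonal_multichoose (a b k : ℕ) :
    ∑ p ∈ Finset.HasAntidiagonal.antidiagonal k, a.multichoose p.1 * b.multichoose p.2 =
      (a + b).multichoose k := by
  induction a generalizing k with
  | zero =>
    cases k with
    | zero => simp
    | succ k => simp [Finset.Nat.antidiagonal_succ]
  | succ a iha =>
    induction k with
    | zero => simp
    | succ k ihk =>
      have h := iha (k + 1)
      rw [Finset.Nat.antidiagonal_succ] at h ⊢
      rw [show a + 1 + b = a + b + 1 by omega, Nat.multichoose_succ_succ, ← h,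
        show a + b + 1 = a + 1 + b by omega, ← ihk]
      simp [Nat.multichoose_succ_succ, add_mul, Finset.sum_add_distrib, add_assoc]

/-- Hockey stick: multisets of size `a + 1` are sorted by their largest element `x`. -/
theorem sum_range_multichoose_succ (m a : ℕ) :
    ∑ x ∈ Finset.range m, (x + 1).multichoose a = m.multichoose (a + 1) := by
  induction m with
  | zero => simp
  | succ m ih => rw [Finset.sum_range_succ, ih, Nat.multichoose_succ_succ]

theorem factorial_mul_multichoose (a k : ℕ) :
    k ! * a.multichoose k = (ascPochhammer ℕ k).eval a := by
  have h := Ring.factorial_nsmul_multichoose_eq_ascPochhammer a k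
  rw [Polynomial.ascPochhammer_smeval_eq_eval, smul_eq_mul] at h
  rw [← h]
  congr 1

/-! ### Lattice points as integer vectors with bounded partial sums -/

/-- The vectors `x` of natural numbers with `x_1 + ⋯ + x_k ≤ s + y_1 + ⋯ + y_k` for all `k`. -/
def boundedVectors : (n : ℕ) → ℕ → (Fin n → ℕ) → Finset (Fin n → ℕ)
  | 0, _, _ => Finset.univ
  | n + 1, s, y => (Finset.range (s + y 0 + 1)).biUnion fun x =>
      (boundedVectors n x (Fin.tail y)).map
        ⟨Fin.cons (s + y 0 - x), Fin.cons_right_injective (α := fun _ => ℕ) _⟩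

theorem sum_Iic_succ {n : ℕ} {M : Type*} [AddCommMonoid M] (f : Fin (n + 1) → M) (k : Fin n) :
    ∑ i ∈ Finset.Iic k.succ, f i = f 0 + ∑ i ∈ Finset.Iic k, f i.succ := by
  have : Finset.Iic k.succ = insert 0 ((Finset.Iic k).map (Fin.succEmb n)) := by
    ext i
    refine Fin.cases ?_ (fun i => ?_) i <;> simp
  rw [this, Finset.sum_insert (by simp), Finset.sum_map]
  rfl

theorem sum_Iic_zero {n : ℕ} {M : Type*} [AddCommMonoid M] (f : Fin (n + 1) → M) :
    ∑ i ∈ Finset.Iic (0 : Fin (n + 1)), f i = f 0 := by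
  have : Finset.Iic (0 : Fin (n + 1)) = {0} := by ext i; simp
  simp [this]

/-- The argument `s` is a slack: when the first coordinate is `s + y 0 - x`, the unused amount `x`
is handed on to the tail. -/
theorem mem_boundedVectors {n : ℕ} (s : ℕ) (y x : Fin n → ℕ) :
    x ∈ boundedVectors n s y ↔
      ∀ k, ∑ i ∈ Finset.Iic k, x i ≤ s + ∑ i ∈ Finset.Iic k, y i := by
  induction n generalizing s with
  | zero => simp [boundedVectors, eq_iff_true_of_subsingleton]
  | succ n ih =>
    simp only [boundedVectors, Finset.mem_biUnion, Finset.mem_range, Finset.mem_map,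
      Function.Embedding.coeFn_mk, ih, Fin.forall_fin_succ, sum_Iic_zero, sum_Iic_succ]
    constructor
    · rintro ⟨a, ha, z, hz, rfl⟩
      simp only [Fin.cons_zero, Fin.cons_succ]
      refine ⟨by omega, fun k => ?_⟩
      have := hz k
      simp only [Fin.tail] at this
      omega
    · rintro ⟨h0, h⟩
      refine ⟨s + y 0 - x 0, by omega, Fin.tail x, fun k => ?_, ?_⟩
      · have := h k
        simp only [Fin.tail]
        omega
      · conv_rhs => rw [← Fin.cons_self_tail x]
        congr 1
        omega

theorem card_boundedVectors_succ (n s : ℕ) (y : Fin (n + 1) → ℕ) :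
    (boundedVectors (n + 1) s y).card =
      ∑ x ∈ Finset.range (s + y 0 + 1), (boundedVectors n x (Fin.tail y)).card := by
  rw [boundedVectors, Finset.card_biUnion]
  · simp
  · intro a ha b hb hab
    rw [Function.onFun, Finset.disjoint_left]
    simp only [Finset.mem_map, Function.Embedding.coeFn_mk, not_exists, not_and]
    rintro _ ⟨z, -, rfl⟩ w - h
    have := congrFun h 0
    simp only [Fin.cons_zero, Finset.coe_range, Set.mem_Iio] at this ha hb
    omega

/-- The vectors `k` of natural numbers with `a + k_1 + ⋯ + k_i ≥ i` for all `i` and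
`a + k_1 + ⋯ + k_n = n`. -/
def ballotVectors : (n : ℕ) → ℕ → Finset (Fin n → ℕ)
  | 0, a => if a = 0 then Finset.univ else ∅
  | n + 1, a => (Finset.range (n + 2)).biUnion fun c =>
      if 1 ≤ a + c then (ballotVectors n (a + c - 1)).map
        ⟨Fin.cons c, Fin.cons_right_injective (α := fun _ => ℕ) _⟩ else ∅

/-- The argument `a` is a running surplus: each coordinate adds its value and then pays one unit, so
`a + c - 1` is passed on. -/
theorem mem_ballotVectors {n : ℕ} (a : ℕ) (k : Fin n → ℕ) :
    k ∈ ballotVectors n a ↔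
      a + ∑ i, k i = n ∧ ∀ i : Fin n, (i : ℕ) + 1 ≤ a + ∑ j ∈ Finset.Iic i, k j := by
  induction n generalizing a with
  | zero =>
    by_cases h : a = 0
    · simp [ballotVectors, h, eq_iff_true_of_subsingleton]
    · simp [ballotVectors, h]
  | succ n ih =>
    simp only [ballotVectors, Finset.mem_biUnion, Finset.mem_range, Fin.forall_fin_succ,
      sum_Iic_zero, sum_Iic_succ, Fin.sum_univ_succ, Fin.val_zero, Fin.val_succ]
    constructor
    · rintro ⟨c, hc, h⟩
      split_ifs at h with hac
      · obtain ⟨z, hz, rfl⟩ := Finset.mem_map.1 h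
        rw [ih] at hz
        simp only [Function.Embedding.coeFn_mk, Fin.cons_zero, Fin.cons_succ]
        refine ⟨by omega, by omega, fun i => ?_⟩
        have := hz.2 i
        omega
      · simp at h
    · rintro ⟨hs, h0, h⟩
      refine ⟨k 0, by omega, ?_⟩
      rw [if_pos (by omega), Finset.mem_map]
      refine ⟨Fin.tail k, (ih _ _).2 ⟨?_, fun i => ?_⟩, Fin.cons_self_tail k⟩
      · simp only [Fin.tail]
        omega
      · have := h i
        simp only [Fin.tail]
        omega

/-- The sum of `∏ i, g i (k i)` over the vectors `k` in `ballotVectors n a`. -/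
def ballotSum (n a : ℕ) (g : Fin n → ℕ → ℕ) : ℕ :=
  ∑ k ∈ ballotVectors n a, ∏ i, g i (k i)

theorem ballotSum_succ (n b : ℕ) (g : Fin (n + 1) → ℕ → ℕ) :
    ballotSum (n + 1) b g = ∑ c ∈ Finset.range (n + 2),
      if 1 ≤ b + c then g 0 c * ballotSum n (b + c - 1) (Fin.tail g) else 0 := by
  rw [ballotSum, ballotVectors, Finset.sum_biUnion]
  · refine Finset.sum_congr rfl fun c _ => ?_
    split_ifs
    · simp [ballotSum, Fin.prod_univ_succ, Finset.mul_sum, Fin.tail]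
    · simp
  · intro c _ d _ hcd
    rw [Function.onFun, Finset.disjoint_left]
    intro k hk hk'
    split_ifs at hk hk'
    · obtain ⟨z, -, rfl⟩ := Finset.mem_map.1 hk
      obtain ⟨w, -, h⟩ := Finset.mem_map.1 hk'
      exact hcd (by simpa using (congrFun h 0).symm)
    all_goals simp_all

theorem ballotSum_eq_zero {n a : ℕ} (h : n < a) (g : Fin n → ℕ → ℕ) : ballotSum n a g = 0 := by
  refine Finset.sum_eq_zero fun k hk => ?_
  have := ((mem_ballotVectors _ _).1 hk).1
  omega

/-- In the induction, hockey stick over the slack gives `(s + 1 + y 0).multichoose (a + 1)`.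
Vandermonde splits `a + 1 = b + c`: `b` stays with the slack, `c` becomes the first ballot
coordinate, and the tail has surplus `b + c - 1 = a`. -/
theorem card_boundedVectors (n s : ℕ) (y : Fin n → ℕ) :
    (boundedVectors n s y).card = ∑ a ∈ Finset.range (n + 1),
      (s + 1).multichoose a * ballotSum n a fun i => (y i).multichoose := by
  induction n generalizing s with
  | zero => simp [boundedVectors, ballotSum, ballotVectors]
  | succ n ih =>
    rw [card_boundedVectors_succ]
    simp_rw [ih]
    rw [Finset.sum_comm]
    have hvd := fun a => sum_antidiagonal_multichoose (s + 1) (y 0) (a + 1)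
    simp_rw [← Finset.sum_mul, sum_range_multichoose_succ,
      show s + y 0 + 1 = (s + 1) + y 0 by omega, ← hvd, Finset.sum_mul,
      ballotSum_succ, Finset.mul_sum]
    -- The remaining pairs `(b, c)` contribute nothing: either `b + c = 0`, or the surplus `b + c -
    -- 1` exceeds `n`.
    rw [Finset.sum_sigma', ← Finset.sum_product',
      ← Finset.sum_filter_add_sum_filter_not
        (Finset.range (n + 1 + 1) ×ˢ Finset.range (n + 2))
        (fun p => 1 ≤ p.1 + p.2 ∧ p.1 + p.2 ≤ n + 1)]
    rw [Finset.sum_eq_zero (s := Finset.filter (fun p => ¬ _) _), add_zero]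
    · refine Finset.sum_bij' (fun p _ => p.2) (fun q _ => ⟨q.1 + q.2 - 1, q⟩) ?_ ?_ ?_ ?_ ?_
      · rintro ⟨a, b, c⟩ h
        simp at h ⊢
        omega
      · rintro ⟨b, c⟩ h
        simp at h ⊢
        omega
      · rintro ⟨a, b, c⟩ h
        simp at h ⊢
        omega
      · rintro ⟨b, c⟩ h
        rfl
      · rintro ⟨a, b, c⟩ h
        simp only [Finset.mem_sigma, Finset.mem_range, Finset.HasAntidiagonal.mem_antidiagonal] at h
        rw [if_pos (by simp; omega)]
        simp only [h.2, Nat.add_sub_cancel, mul_assoc]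
        rfl
    · rintro ⟨b, c⟩ h
      simp only [Finset.mem_filter, not_and, not_le] at h
      split_ifs with h1
      · rw [ballotSum_eq_zero (by have := h.2 h1; dsimp only at this ⊢; omega), mul_zero, mul_zero]
      · simp

/-- With no slack, hockey stick alone gives `(y 0 + 1).multichoose (a + 1)`; no Vandermonde split is
needed, and the first coordinate absorbs the extra `1`. -/
theorem card_boundedVectors_zero (n : ℕ) (y : Fin (n + 1) → ℕ) :
    (boundedVectors (n + 1) 0 y).card =
      ballotSum (n + 1) 0 fun i => (y i + if i = 0 then 1 else 0).multichoose := by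
  rw [card_boundedVectors_succ]
  simp_rw [card_boundedVectors]
  rw [Finset.sum_comm]
  simp_rw [← Finset.sum_mul, sum_range_multichoose_succ]
  rw [ballotSum_succ, Finset.sum_range_succ' _ (n + 1)]
  simp [Fin.tail_def, Fin.succ_ne_zero]

/-! ### Functions with prescribed fibre sizes -/

/-- The number of elements of the fibre of `β` over `i`. -/
def fiberCard {n : ℕ} {ι : Type*} [DecidableEq ι] (β : Fin n → ι) (i : ι) : ℕ :=
  (Finset.univ.filter fun j => β j = i).card

theorem sum_fiberCard {n : ℕ} {ι : Type*} [DecidableEq ι] (β : Fin n → ι) (s : Finset ι) :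
    ∑ i ∈ s, fiberCard β i = (Finset.univ.filter fun j => β j ∈ s).card := by
  simp only [fiberCard, Finset.card_eq_sum_ones, Finset.sum_filter]
  rw [Finset.sum_comm]
  simp

/-- Both numbers are the coefficient of the monomial with exponents `k` in `(∑ X_i)^n`, expanded
word by word or by the multinomial theorem. -/
theorem card_fiberCard_eq {n : ℕ} {ι : Type*} [Fintype ι] [DecidableEq ι] (k : ι → ℕ)
    (hk : ∑ i, k i = n) :
    (Finset.univ.filter fun β : Fin n → ι => fiberCard β = k).card =
      Nat.multinomial Finset.univ k := by
  have h := Finset.sum_pow_eq_sum_piAntidiag (R := MvPolynomial ι ℕ) Finset.univ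
    (fun i => MvPolynomial.X i) n
  rw [Finset.sum_pow'] at h
  have hmon : ∀ l : ι → ℕ, ∏ i, (MvPolynomial.X i : MvPolynomial ι ℕ) ^ l i =
      MvPolynomial.monomial (Finsupp.equivFunOnFinite.symm l) 1 := by
    intro l
    rw [MvPolynomial.monomial_eq, Finsupp.prod_fintype _ _ (by simp)]
    simp
  have hfib : ∀ β : Fin n → ι, ∏ j, (MvPolynomial.X (β j) : MvPolynomial ι ℕ) =
      ∏ i, MvPolynomial.X i ^ fiberCard β i := by
    intro β
    rw [← Finset.prod_fiberwise (s := Finset.univ) (g := β)]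
    refine Finset.prod_congr rfl fun i _ => ?_
    rw [fiberCard, ← Finset.prod_const]
    exact Finset.prod_congr rfl fun j hj => by rw [(Finset.mem_filter.1 hj).2]
  simp_rw [hfib, hmon] at h
  have h2 := congrArg (MvPolynomial.coeff (Finsupp.equivFunOnFinite.symm k)) h
  simp only [MvPolynomial.coeff_sum, ← MvPolynomial.C_eq_coe_nat, MvPolynomial.coeff_C_mul,
    MvPolynomial.coeff_monomial, Equiv.apply_eq_iff_eq] at h2
  simp only [mul_ite, mul_one, mul_zero] at h2
  rw [Finset.sum_ite_eq' (Finset.piAntidiag Finset.univ n) k, if_pos (by simp [hk])] at h2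
  rw [Finset.card_filter, ← Fintype.piFinset_univ, h2, Nat.cast_id]

theorem sum_comp_fiberCard {n : ℕ} (Φ : (Fin n → ℕ) → ℕ) :
    ∑ β : Fin n → Fin n with fiberCard β ∈ ballotVectors n 0, Φ (fiberCard β) =
      ∑ k ∈ ballotVectors n 0, Nat.multinomial Finset.univ k * Φ k := by
  rw [← Finset.sum_fiberwise_of_maps_to (g := fiberCard) (t := ballotVectors n 0) (by simp)]
  refine Finset.sum_congr rfl fun k hk => ?_
  rw [← card_fiberCard_eq k (by simpa using ((mem_ballotVectors _ _).1 hk).1), ← smul_eq_mul,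
    ← Finset.sum_const]
  refine Finset.sum_congr ?_ fun β hβ => by rw [(Finset.mem_filter.1 hβ).2]
  ext β
  simp only [Finset.mem_filter, Finset.mem_univ, true_and, and_iff_right_iff_imp]
  rintro rfl
  exact hk

theorem factorial_mul_card_boundedVectors (n : ℕ) (y : Fin (n + 1) → ℕ) :
    (n + 1)! * (boundedVectors (n + 1) 0 y).card =
      ∑ β : Fin (n + 1) → Fin (n + 1) with fiberCard β ∈ ballotVectors (n + 1) 0,
        ∏ i, (ascPochhammer ℕ (fiberCard β i)).eval (y i + if i = 0 then 1 else 0) := by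
  rw [card_boundedVectors_zero, sum_comp_fiberCard
    (fun k => ∏ i, (ascPochhammer ℕ (k i)).eval (y i + if i = 0 then 1 else 0)), ballotSum,
    Finset.mul_sum]
  refine Finset.sum_congr rfl fun k hk => ?_
  have hk1 : ∑ i, k i = n + 1 := by simpa using ((mem_ballotVectors _ _).1 hk).1
  have hk2 := Nat.multinomial_spec Finset.univ k
  rw [hk1] at hk2
  rw [← hk2]
  simp_rw [← factorial_mul_multichoose, Finset.prod_mul_distrib]
  ring


/-! ### Blocks -/

theorem mem_block {n : ℕ} {y : Fin n → ℕ} {i : Fin n} {s : ℕ} :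
    s ∈ block y i ↔ blockStart y i < s ∧ s ≤ blockStart y i + y i := by
  simp [block]

theorem blockStart_add {n : ℕ} (y : Fin n → ℕ) (i : Fin n) :
    blockStart y i + y i = ∑ k ∈ Finset.Iic i, y k := by
  rw [blockStart, ← Finset.Iio_insert, Finset.sum_insert (by simp), add_comm]

theorem sum_Iic_le_blockStart {n : ℕ} (y : Fin n → ℕ) {i j : Fin n} (h : i < j) :
    ∑ k ∈ Finset.Iic i, y k ≤ blockStart y j := by
  refine Finset.sum_le_sum_of_subset fun k hk => ?_
  simp only [Finset.mem_Iic, Finset.mem_Iio] at hk ⊢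
  exact hk.trans_lt h

theorem le_sum_Iic_iff {n : ℕ} {y : Fin n → ℕ} {i j : Fin n} {s : ℕ} (hs : s ∈ block y i) :
    s ≤ ∑ k ∈ Finset.Iic j, y k ↔ i ≤ j := by
  rw [mem_block] at hs
  constructor
  · intro h
    by_contra! hij
    have := sum_Iic_le_blockStart y hij
    omega
  · intro h
    rw [blockStart_add] at hs
    exact hs.2.trans (Finset.sum_le_sum_of_subset (Finset.Iic_subset_Iic.2 h))

theorem block_unique {n : ℕ} {y : Fin n → ℕ} {i j : Fin n} {s : ℕ} (hi : s ∈ block y i)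
    (hj : s ∈ block y j) : i = j :=
  le_antisymm ((le_sum_Iic_iff hi).1 ((le_sum_Iic_iff hj).2 le_rfl))
    ((le_sum_Iic_iff hj).1 ((le_sum_Iic_iff hi).2 le_rfl))

theorem exists_mem_block {n : ℕ} (y : Fin n → ℕ) {s : ℕ} (h0 : 0 < s) (h : s ≤ ∑ i, y i) :
    ∃ i, s ∈ block y i := by
  have hne : ((Finset.univ : Finset (Fin n)).filter
      fun i => s ≤ ∑ k ∈ Finset.Iic i, y k).Nonempty := by
    cases n with
    | zero => simp at h; omega
    | succ n =>
      refine ⟨Fin.last n, ?_⟩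
      have : Finset.Iic (Fin.last n) = Finset.univ := by ext; simp [Fin.le_last]
      simpa [this] using h
  -- The block sought is the first whose end reaches `s`; minimality against the preceding index
  -- puts `s` after its start.
  obtain ⟨i, hi⟩ := Finset.exists_minimal hne
  refine ⟨i, mem_block.2 ⟨?_, by simpa [blockStart_add] using hi.1⟩⟩
  by_contra! hle
  rcases Nat.eq_zero_or_pos (i : ℕ) with h1 | h1
  · have : Finset.Iio i = ∅ := by
      ext j
      simp [Fin.lt_def, h1]
    simp [blockStart, this] at hle
    omega
  · let j : Fin n := ⟨i - 1, by omega⟩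
    have hj : Finset.Iio i = Finset.Iic j := by
      ext k
      simp only [Finset.mem_Iio, Finset.mem_Iic, Fin.lt_def, Fin.le_def, j]
      omega
    have hji : j ≤ i := by simp [Fin.le_def, j]
    have := hi.2 (by simpa [blockStart, hj] using hle) hji
    simp [Fin.le_def, j] at this
    omega

/-! ### Parking in a block -/

/-- In terms of the offset from the first space of the block, advancing is adding `1` modulo `y i`.
-/
theorem advance_iterate {n : ℕ} (y : Fin n → ℕ) (i : Fin n) {r : ℕ} (hr : r < y i) (k : ℕ) :
    (advance y i)^[k] (blockStart y i + 1 + r) = blockStart y i + 1 + (r + k) % y i := by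
  induction k with
  | zero => simp [Nat.mod_eq_of_lt hr]
  | succ k ih =>
    rw [Function.iterate_succ_apply', ih, advance]
    have h1 := Nat.mod_lt (r + k) (by omega : 0 < y i)
    rw [show (r + (k + 1)) % y i = ((r + k) % y i + 1) % y i by simp [add_assoc]]
    split_ifs with h
    · have h2 : (r + k) % y i = y i - 1 := by omega
      rw [h2, Nat.sub_add_cancel (by omega), Nat.mod_self]
    · rw [Nat.mod_eq_of_lt (show (r + k) % y i + 1 < y i by omega), add_assoc]

theorem exists_eq_add_of_mem_block {n : ℕ} {y : Fin n → ℕ} {i : Fin n} {w : ℕ}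
    (hw : w ∈ block y i) : ∃ r < y i, w = blockStart y i + 1 + r := by
  rw [mem_block] at hw
  exact ⟨w - (blockStart y i + 1), by omega, by omega⟩

theorem advance_iterate_mem {n : ℕ} {y : Fin n → ℕ} {i : Fin n} {w : ℕ} (hw : w ∈ block y i)
    (k : ℕ) : (advance y i)^[k] w ∈ block y i := by
  obtain ⟨r, hr, rfl⟩ := exists_eq_add_of_mem_block hw
  have := Nat.mod_lt (r + k) (by omega : 0 < y i)
  rw [advance_iterate y i hr, mem_block]
  omega

theorem exists_advance_iterate_eq {n : ℕ} {y : Fin n → ℕ} {i : Fin n} {w s : ℕ}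
    (hw : w ∈ block y i) (hs : s ∈ block y i) : ∃ k < y i, (advance y i)^[k] w = s := by
  obtain ⟨r, hr, rfl⟩ := exists_eq_add_of_mem_block hw
  obtain ⟨q, hq, rfl⟩ := exists_eq_add_of_mem_block hs
  -- This is `q - r` modulo `y i`, written without truncated subtraction.
  refine ⟨(q + (y i - r)) % y i, Nat.mod_lt _ (by omega), ?_⟩
  rw [advance_iterate y i hr, Nat.add_mod_mod, show r + (q + (y i - r)) = q + y i by omega,
    Nat.add_mod_right, Nat.mod_eq_of_lt hq]

theorem park_eq {n : ℕ} {y : Fin n → ℕ} {i : Fin n} {w : ℕ} (hw : w ∈ block y i)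
    (O : Finset ℕ) :
    park y O w = ((List.range (y i)).map fun k => (advance y i)^[k] w).find? fun s => s ∉ O := by
  have : ((List.finRange n).find? fun i => w ∈ block y i) = some i := by
    rcases h : (List.finRange n).find? fun i => decide (w ∈ block y i) with _ | j
    · have := List.find?_eq_none.1 h i (List.mem_finRange i)
      simp [hw] at this
    · have := List.find?_some h
      rw [block_unique hw (by simpa using this)]
  rw [park, this]
  rfl

theorem mem_of_park_eq_some {n : ℕ} {y : Fin n → ℕ} {i : Fin n} {w s : ℕ} {O : Finset ℕ}
    (hw : w ∈ block y i) (h : park y O w = some s) : s ∈ block y i ∧ s ∉ O := by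
  rw [park_eq hw] at h
  refine ⟨?_, by simpa using List.find?_some h⟩
  obtain ⟨k, -, rfl⟩ := List.mem_map.1 (List.mem_of_find?_eq_some h)
  exact advance_iterate_mem hw k

theorem park_eq_none_iff {n : ℕ} {y : Fin n → ℕ} {i : Fin n} {w : ℕ} {O : Finset ℕ}
    (hw : w ∈ block y i) : park y O w = none ↔ block y i ⊆ O := by
  rw [park_eq hw, List.find?_eq_none]
  constructor
  · intro h s hs
    obtain ⟨k, hk, rfl⟩ := exists_advance_iterate_eq hw hs
    simpa using h _ (List.mem_map.2 ⟨k, List.mem_range.2 hk, rfl⟩)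
  · intro h s hs
    obtain ⟨k, -, rfl⟩ := List.mem_map.1 hs
    simpa using h (advance_iterate_mem hw k)

theorem park_eq_some_self_iff {n : ℕ} {y : Fin n → ℕ} {i : Fin n} {w : ℕ} {O : Finset ℕ}
    (hw : w ∈ block y i) : park y O w = some w ↔ w ∉ O := by
  refine ⟨fun h => (mem_of_park_eq_some hw h).2, fun h => ?_⟩
  obtain ⟨r, hr, -⟩ := exists_eq_add_of_mem_block hw
  obtain ⟨m, hm⟩ : ∃ m, y i = m + 1 := ⟨y i - 1, by omega⟩
  rw [park_eq hw, hm, List.range_succ_eq_map]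
  simp [h]

/-! ### The occupied spaces -/

/-- Later cars do not affect earlier ones, which permits induction on the number of cars by removing
the last. -/
theorem occupied_castSucc {n r : ℕ} (y : Fin n → ℕ) (l : Option (Fin n)) (w : Fin r → ℕ) (x : ℕ)
    {j : ℕ} (hj : j ≤ r) :
    occupied y l (Fin.snoc w x : Fin (r + 1) → ℕ) j = occupied y l w j := by
  induction j with
  | zero => rfl
  | succ j ih =>
    have h1 : j < r := hj
    have h2 : j < r + 1 := by omega
    have h3 : (Fin.snoc w x : Fin (r + 1) → ℕ) ⟨j, h2⟩ = w ⟨j, h1⟩ :=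
      Fin.snoc_castSucc (α := fun _ => ℕ) x w ⟨j, h1⟩
    rw [occupied, occupied, dif_pos h1, dif_pos h2, ih (by omega), h3]

theorem occupied_snoc {n r : ℕ} (y : Fin n → ℕ) (l : Option (Fin n)) (w : Fin r → ℕ) (x : ℕ) :
    occupied y l (Fin.snoc w x : Fin (r + 1) → ℕ) (r + 1) =
      occupied y l w r ∪ (park y (occupied y l w r) x).toFinset := by
  have h3 : (Fin.snoc w x : Fin (r + 1) → ℕ) ⟨r, r.lt_succ_self⟩ = x :=
    Fin.snoc_last (α := fun _ => ℕ) x w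
  rw [occupied, dif_pos r.lt_succ_self, occupied_castSucc y l w x le_rfl, h3]

theorem outcome_snoc_castSucc {n r : ℕ} (y : Fin n → ℕ) (l : Option (Fin n)) (w : Fin r → ℕ)
    (x : ℕ) (j : Fin r) :
    outcome y l (Fin.snoc w x : Fin (r + 1) → ℕ) j.castSucc = outcome y l w j := by
  rw [outcome, Fin.snoc_castSucc, Fin.val_castSucc, occupied_castSucc y l w x j.is_lt.le, outcome]

theorem outcome_snoc_last {n r : ℕ} (y : Fin n → ℕ) (l : Option (Fin n)) (w : Fin r → ℕ)
    (x : ℕ) :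
    outcome y l (Fin.snoc w x : Fin (r + 1) → ℕ) (Fin.last r) = park y (occupied y l w r) x := by
  rw [outcome, Fin.snoc_last, Fin.val_last, occupied_castSucc y l w x le_rfl]

theorem fiberCard_snoc {r : ℕ} {ι : Type*} [DecidableEq ι] (β : Fin r → ι) (b i : ι) :
    fiberCard (Fin.snoc β b : Fin (r + 1) → ι) i = fiberCard β i + if b = i then 1 else 0 := by
  simp only [fiberCard, Finset.card_filter, Fin.sum_univ_castSucc, Fin.snoc_castSucc,
    Fin.snoc_last]

theorem fiberCard_le {r : ℕ} {ι : Type*} [DecidableEq ι] (β : Fin r → ι) (i : ι) :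
    fiberCard β i ≤ r :=
  (Finset.card_filter_le _ _).trans_eq (Finset.card_fin r)

theorem card_unavailable_inter_block {n : ℕ} (y : Fin n → ℕ) {l : Fin n} (hl : 0 < y l)
    (i : Fin n) : (unavailable y (some l) ∩ block y i).card = if i = l then 1 else 0 := by
  have h1 : unavailable y (some l) = {blockStart y l + 1} := by
    ext s
    simp only [unavailable, Finset.mem_filter, mem_block, Finset.mem_singleton]
    omega
  have h2 : blockStart y l + 1 ∈ block y l := by
    rw [mem_block]
    omega
  rw [h1]
  split_ifs with h
  · rw [h, Finset.inter_eq_left.2 (by simpa using h2), Finset.card_singleton]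
  · rw [Finset.singleton_inter_of_notMem fun h3 => h (block_unique h3 h2), Finset.card_empty]

/-- The number of spaces of each block that are taken. -/
theorem card_occupied_inter_block {n r : ℕ} (y : Fin n → ℕ) {l : Fin n} (hl : 0 < y l)
    (β : Fin r → Fin n) (w : Fin r → ℕ) (hw : ∀ j, w j ∈ block y (β j)) (i : Fin n) :
    (occupied y (some l) w r ∩ block y i).card =
      min (y i) (fiberCard β i + if i = l then 1 else 0) := by
  induction r with
  | zero =>
    rw [occupied, card_unavailable_inter_block y hl]
    simp only [fiberCard, Finset.univ_eq_empty, Finset.filter_empty, Finset.card_empty, zero_add]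
    split_ifs with h
    · subst h
      omega
    · simp
  | succ r ih =>
    obtain ⟨w, x, rfl⟩ : ∃ w' x, w = Fin.snoc w' x := ⟨_, _, (Fin.snoc_init_self w).symm⟩
    obtain ⟨β, b, rfl⟩ : ∃ β' b, β = Fin.snoc β' b := ⟨_, _, (Fin.snoc_init_self β).symm⟩
    have hx : x ∈ block y b := by simpa using hw (Fin.last r)
    have ih := ih β w fun j => by simpa using hw j.castSucc
    rw [occupied_snoc, fiberCard_snoc]
    set O := occupied y (some l) w r
    have hcard : (block y i).card = y i := by simp [block]
    rcases hp : park y O x with _ | s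
    · have hsub := (park_eq_none_iff hx).1 hp
      rw [Option.toFinset_none, Finset.union_empty]
      by_cases h1 : b = i
      · subst h1
        have hfull : (O ∩ block y b).card = y b := by rw [Finset.inter_eq_right.2 hsub, hcard]
        rw [if_pos rfl]
        omega
      · rw [ih, if_neg h1, add_zero]
    · obtain ⟨hs, hsO⟩ := mem_of_park_eq_some hx hp
      rw [Option.toFinset_some, Finset.union_inter_distrib_right]
      by_cases h1 : b = i
      · subst h1
        rw [Finset.singleton_inter_of_mem hs, Finset.union_comm, ← Finset.insert_eq,
          Finset.card_insert_of_notMem (by simp [hsO])]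
        have hlt : (O ∩ block y b).card < y b := by
          rw [← hcard]
          refine Finset.card_lt_card ⟨Finset.inter_subset_right, fun h => hsO ?_⟩
          exact (Finset.mem_inter.1 (h hs)).1
        simp only [if_true]
        omega
      · rw [Finset.singleton_inter_of_notMem fun h => h1 (block_unique hs h), Finset.union_empty,
          ih, if_neg h1, add_zero]

/-! ### The generating function of lucky cars -/

/-- The sum over all preference vectors with prescribed blocks of the product of the weights of
the cars, a lucky car having weight `a` and an unlucky car weight `1 + a`. -/
theorem sum_prod_lucky {n r : ℕ} {R : Type*} [CommSemiring R] (a : R) (y : Fin n → ℕ) {l : Fin n}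
    (hl : r ≤ y l) (hl0 : 0 < y l) (hy : ∀ i, r ≤ y i + 1) (β : Fin r → Fin n) :
    ∑ w ∈ Fintype.piFinset fun j => block y (β j),
        ∏ j, (if outcome y (some l) w j = some (w j) then a else 1 + a) =
      ∏ i, (ascPochhammer R (fiberCard β i)).eval (y i * a + if i = l then 1 else 0) := by
  induction r with
  | zero => simp [fiberCard]
  | succ r ih =>
    obtain ⟨β, b, rfl⟩ : ∃ β' b, β = Fin.snoc β' b := ⟨_, _, (Fin.snoc_init_self β).symm⟩
    -- The total weight of the last car over its preferences in block `b` depends only on how many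
    -- spaces are taken, and is the next factor of the rising factorial.
    have key : ∀ w ∈ Fintype.piFinset (fun j => block y (β j)), ∑ x ∈ block y b,
        (if park y (occupied y (some l) w r) x = some x then a else 1 + a) =
          y b * a + (if b = l then 1 else 0) + fiberCard β b := by
      intro w hw
      have hO := card_occupied_inter_block y hl0 β w (by simpa using hw) b
      -- The size hypotheses ensure that the earlier cars of the block all found a space. In a block
      -- with `y b = r`, the last car itself may be turned away, and then counts as unlucky.
      have hm : fiberCard β b + (if b = l then 1 else 0) ≤ y b := by
        have h1 := fiberCard_le β b
        have h2 := hy b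
        split_ifs with h
        · subst h
          omega
        · omega
      rw [min_eq_right hm, Finset.inter_comm, ← Finset.filter_mem_eq_inter] at hO
      have hsum := Finset.card_filter_add_card_filter_not (s := block y b)
        (fun x => x ∈ occupied y (some l) w r)
      rw [show (block y b).card = y b by simp [block]] at hsum
      have hite : ∀ x ∈ block y b,
          (if park y (occupied y (some l) w r) x = some x then a else 1 + a) =
            if x ∈ occupied y (some l) w r then 1 + a else a := by
        intro x hx
        simp only [park_eq_some_self_iff hx, ite_not]
      rw [Finset.sum_congr rfl hite, Finset.sum_ite, Finset.sum_const, Finset.sum_const]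
      rw [← hsum, nsmul_eq_mul, nsmul_eq_mul, mul_add, hO]
      push_cast
      ring
    have hsplit : ∑ w ∈ Fintype.piFinset fun j => block y ((Fin.snoc β b : Fin (r + 1) → Fin n) j),
        ∏ j, (if outcome y (some l) w j = some (w j) then a else 1 + a) =
      ∑ w ∈ Fintype.piFinset fun j => block y (β j), ∑ x ∈ block y b,
        (∏ j, (if outcome y (some l) w j = some (w j) then a else 1 + a)) *
          if park y (occupied y (some l) w r) x = some x then a else 1 + a := by
      rw [← Finset.sum_product']
      refine Finset.sum_bij' (fun w _ => (Fin.init w, w (Fin.last r)))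
        (fun p _ => Fin.snoc p.1 p.2) ?_ ?_ ?_ ?_ ?_
      · intro w hw
        simp only [Fintype.mem_piFinset, Finset.mem_product] at hw ⊢
        exact ⟨fun j => by simpa [Fin.init] using hw j.castSucc, by simpa using hw (Fin.last r)⟩
      · rintro ⟨w, x⟩ hw
        simp only [Fintype.mem_piFinset, Finset.mem_product] at hw ⊢
        refine Fin.lastCases ?_ fun j => ?_
        · simpa using hw.2
        · simpa using hw.1 j
      · simp
      · simp
      · intro w hw
        obtain ⟨w, x, rfl⟩ : ∃ w' x, w = Fin.snoc w' x := ⟨_, _, (Fin.snoc_init_self w).symm⟩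
        rw [Fin.prod_univ_castSucc]
        simp only [outcome_snoc_castSucc, outcome_snoc_last, Fin.snoc_castSucc, Fin.snoc_last,
          Fin.init_snoc]
    rw [hsplit]
    simp_rw [← Finset.mul_sum]
    rw [Finset.sum_congr rfl fun w hw => by rw [key w hw], ← Finset.sum_mul,
      ih (by omega) (fun i => by have := hy i; omega)]
    rw [← Finset.prod_erase_mul _ _ (Finset.mem_univ b),
      ← Finset.prod_erase_mul _ _ (Finset.mem_univ b), mul_assoc, fiberCard_snoc, if_pos rfl, ascPochhammer_succ_eval]
    congr 1
    refine Finset.prod_congr rfl fun i hi => ?_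
    rw [fiberCard_snoc, if_neg (Finset.ne_of_mem_erase hi).symm, add_zero]


/-! ### Parking functions by blocks -/

/-- Sorting preserves the number of entries that are at most `a`, so conditions on order statistics
become counts. The index starts at `0`, hence the strict inequality. -/
theorem sort_apply_le_iff {n : ℕ} (σ : Fin n → ℕ) (i : Fin n) (a : ℕ) :
    (σ ∘ Tuple.sort σ) i ≤ a ↔ (i : ℕ) < (Finset.univ.filter fun j => σ j ≤ a).card := by
  rw [← Tuple.lt_card_le_iff_apply_le_of_monotone (Tuple.monotone_sort σ)]
  have : (Finset.univ.filter fun j => (σ ∘ Tuple.sort σ) j ≤ a).card =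
      (Finset.univ.filter fun j => σ j ≤ a).card :=
    Finset.card_equiv (Tuple.sort σ) (by simp)
  rw [this]

theorem card_filter_le_sum_Iic {n : ℕ} {y σ : Fin n → ℕ} {β : Fin n → Fin n}
    (h : ∀ j, σ j ∈ block y (β j)) (i : Fin n) :
    (Finset.univ.filter fun j => σ j ≤ ∑ k ∈ Finset.Iic i, y k).card =
      ∑ k ∈ Finset.Iic i, fiberCard β k := by
  rw [sum_fiberCard]
  congr 1
  ext j
  simp [le_sum_Iic_iff (h j)]

/-- An entry is at most `y_1 + ⋯ + y_i` exactly when its block is among the first `i`, so the counts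
in the parking condition are partial sums of fibre sizes. -/
theorem isParkingFunction_iff {n : ℕ} (y σ : Fin n → ℕ) :
    IsParkingFunction y σ ↔
      ∃ β : Fin n → Fin n, fiberCard β ∈ ballotVectors n 0 ∧ ∀ j, σ j ∈ block y (β j) := by
  simp only [IsParkingFunction, sort_apply_le_iff, mem_ballotVectors, zero_add]
  constructor
  · rintro ⟨h0, h⟩
    have hle : ∀ j, σ j ≤ ∑ i, y i := by
      intro j
      obtain ⟨m, rfl⟩ : ∃ m, n = m + 1 := ⟨n - 1, by have := j.is_lt; omega⟩
      -- The condition at the last index bounds every entry by the total, so each entry lies in a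
      -- block.
      have hl := h (Fin.last m)
      have hI : Finset.Iic (Fin.last m) = Finset.univ := by ext; simp [Fin.le_last]
      rw [hI, Fin.val_last] at hl
      have hcard : (Finset.univ.filter fun j => σ j ≤ ∑ i, y i).card =
          (Finset.univ : Finset (Fin (m + 1))).card :=
        le_antisymm (Finset.card_filter_le _ _) (by simpa using hl)
      exact Finset.filter_eq_self.1
        (Finset.eq_of_subset_of_card_le (Finset.filter_subset _ _) hcard.ge) j (Finset.mem_univ j)
    choose β hβ using fun j => exists_mem_block y (h0 j) (hle j)
    refine ⟨β, ⟨by simp [sum_fiberCard], fun i => ?_⟩, hβ⟩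
    rw [← card_filter_le_sum_Iic hβ]
    exact h i
  · rintro ⟨β, ⟨-, h⟩, hβ⟩
    refine ⟨fun j => (Nat.zero_le _).trans_lt (mem_block.1 (hβ j)).1, fun i => ?_⟩
    rw [card_filter_le_sum_Iic hβ]
    exact h i

/-- The finite set of all `y`-parking functions. -/
def parkingFunctions {n : ℕ} (y : Fin n → ℕ) : Finset (Fin n → ℕ) :=
  (Finset.univ.filter fun β : Fin n → Fin n => fiberCard β ∈ ballotVectors n 0).biUnion
    fun β => Fintype.piFinset fun j => block y (β j)

theorem mem_parkingFunctions {n : ℕ} (y σ : Fin n → ℕ) :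
    σ ∈ parkingFunctions y ↔ IsParkingFunction y σ := by
  simp [parkingFunctions, isParkingFunction_iff]

theorem sum_parkingFunctions {n : ℕ} {M : Type*} [AddCommMonoid M] (y : Fin n → ℕ)
    (f : (Fin n → ℕ) → M) :
    ∑ σ ∈ parkingFunctions y, f σ =
      ∑ β : Fin n → Fin n with fiberCard β ∈ ballotVectors n 0,
        ∑ σ ∈ Fintype.piFinset fun j => block y (β j), f σ := by
  refine Finset.sum_biUnion fun β _ γ _ hne => ?_
  rw [Function.onFun, Finset.disjoint_left]
  intro σ h1 h2
  rw [Fintype.mem_piFinset] at h1 h2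
  exact hne (funext fun j => block_unique (h1 j) (h2 j))

/-- The generating function of lucky cars at a natural number counts lattice points. -/
theorem sum_parkingFunctions_lucky {n : ℕ} (hn : 0 < n) (y : Fin n → ℕ)
    (hy : ∀ i, n - 1 ≤ y i) (hy1 : n ≤ y ⟨0, hn⟩) (t : ℕ) :
    ∑ σ ∈ parkingFunctions y, t ^ (luckyCars y (some ⟨0, hn⟩) σ).card *
        (1 + t) ^ (n - (luckyCars y (some ⟨0, hn⟩) σ).card) =
      n ! * (boundedVectors n 0 fun i => t * y i).card := by
  obtain ⟨n, rfl⟩ : ∃ m, n = m + 1 := ⟨n - 1, by omega⟩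
  rw [factorial_mul_card_boundedVectors, sum_parkingFunctions]
  refine Finset.sum_congr rfl fun β _ => ?_
  have h := sum_prod_lucky t y (l := ⟨0, hn⟩) hy1 (by omega)
    (fun i => by have := hy i; omega) β
  simp only [Nat.cast_id, mul_comm (y _) t] at h
  rw [show (0 : Fin (n + 1)) = ⟨0, hn⟩ from rfl, ← h]
  refine Finset.sum_congr rfl fun σ _ => ?_
  rw [Finset.prod_ite, Finset.prod_const, Finset.prod_const, luckyCars]
  congr 2
  have := Finset.card_filter_add_card_filter_not (s := (Finset.univ : Finset (Fin (n + 1))))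
    (fun j => outcome y (some ⟨0, hn⟩) σ j = some (σ j))
  rw [Finset.card_fin] at this
  omega

/-! ### Lattice points of dilates -/

theorem smul_polytope {n : ℕ} (y : Fin n → ℕ) {t : ℕ} (ht : 0 < t) :
    (t : ℝ) • polytope y = polytope fun i => t * y i := by
  have ht' : (0 : ℝ) < t := by exact_mod_cast ht
  ext x
  rw [Set.mem_smul_set_iff_inv_smul_mem₀ ht'.ne']
  simp only [polytope, Set.mem_ofPred_eq, Pi.smul_apply, smul_eq_mul, ← Finset.mul_sum,
    Nat.cast_mul]
  refine and_congr (forall_congr' fun i => ?_) (forall_congr' fun k => ?_)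
  · exact mul_nonneg_iff_of_pos_left (inv_pos.2 ht')
  · rw [inv_mul_le_iff₀ ht']

theorem latticePointCount_polytope {n : ℕ} (y : Fin n → ℕ) :
    latticePointCount (polytope y) = (boundedVectors n 0 y).card := by
  have : {z : Fin n → ℤ | (fun i => (z i : ℝ)) ∈ polytope y} =
      (fun (x : Fin n → ℕ) i => (x i : ℤ)) '' (boundedVectors n 0 y : Set (Fin n → ℕ)) := by
    ext z
    simp only [polytope, Set.mem_ofPred_eq, Set.mem_image, SetLike.mem_coe, mem_boundedVectors,
      zero_add]
    constructor
    · rintro ⟨h0, h⟩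
      have h0' : ∀ i, ((z i).toNat : ℤ) = z i := fun i =>
        Int.toNat_of_nonneg (by exact_mod_cast h0 i)
      refine ⟨fun i => (z i).toNat, fun k => ?_, funext h0'⟩
      have := h k
      zify
      simp_rw [h0']
      exact_mod_cast this
    · rintro ⟨x, h, rfl⟩
      refine ⟨fun i => by simp, fun k => ?_⟩
      have := h k
      simp only [Int.cast_natCast]
      exact_mod_cast this
  rw [latticePointCount, this, Set.ncard_image_of_injective, Set.ncard_coe_finset]
  intro a b h
  funext i
  exact Int.ofNat_injective (congrFun h i)

/-! ### Magic expansions -/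

theorem coeff_X_pow_mul_one_add_X_pow (c : ℝ) (n i j : ℕ) :
    (Polynomial.C c * (Polynomial.X ^ i * (1 + Polynomial.X) ^ n) : ℝ[X]).coeff j =
      if i ≤ j then c * (n.choose (j - i) : ℝ) else 0 := by
  rw [Polynomial.coeff_C_mul, Polynomial.coeff_X_pow_mul']
  split_ifs
  · rw [Polynomial.coeff_one_add_X_pow]
  · simp

/-- The basis is triangular: `t^j (1 + t)^(d - j)` has lowest term `t^j` with coefficient `1`, so
the coefficients are determined successively. -/
theorem eq_of_isMagicExpansion {d : ℕ} {p : ℝ[X]} {c c' : Fin (d + 1) → ℝ}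
    (h : IsMagicExpansion d p c) (h' : IsMagicExpansion d p c') : c = c' := by
  have key : ∀ m, ∀ j : Fin (d + 1), (j : ℕ) = m → c j = c' j := by
    intro m
    induction m using Nat.strong_induction_on with
    | _ m ih =>
      rintro j rfl
      have heq := congrArg (fun q : ℝ[X] => q.coeff (j : ℕ)) (h.symm.trans h')
      simp only [Polynomial.finsetSum_coeff, coeff_X_pow_mul_one_add_X_pow] at heq
      rw [← Finset.add_sum_erase _ _ (Finset.mem_univ j),
        ← Finset.add_sum_erase _ _ (Finset.mem_univ j)] at heq
      rw [Finset.sum_congr rfl (g := fun i : Fin (d + 1) => if (i : ℕ) ≤ j then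
        c' i * ((d - (i : ℕ)).choose (j - i) : ℝ) else 0)] at heq
      · have heq := add_right_cancel heq
        simpa using heq
      · intro i hi
        split_ifs with hij
        · have : (i : ℕ) ≠ j := fun h => Finset.ne_of_mem_erase hi (Fin.ext h)
          rw [ih i (by omega) i rfl]
        · rfl
  exact funext fun j => key j j rfl

/-- Every basis element is monic of degree `d`, so the coefficient of `t^d` is the sum of the `c j`.
-/
theorem natDegree_of_isMagicExpansion {d : ℕ} {p : ℝ[X]} {c : Fin (d + 1) → ℝ}
    (h : IsMagicExpansion d p c) (hc : ∑ j, c j ≠ 0) : p.natDegree = d := by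
  refine Polynomial.natDegree_eq_of_le_of_coeff_ne_zero ?_ ?_
  · rw [h]
    refine Polynomial.natDegree_sum_le_of_forall_le _ _ fun j _ => ?_
    compute_degree
    omega
  · rw [h, Polynomial.finsetSum_coeff]
    convert hc using 2 with j
    rw [coeff_X_pow_mul_one_add_X_pow, if_pos j.is_le]
    simp

/-! ### The magic coefficients of the Ehrhart polynomial -/

theorem IsEhrhartPolynomial.unique {n : ℕ} {P : Set (Fin n → ℝ)} {p q : ℝ[X]}
    (hp : IsEhrhartPolynomial P p) (hq : IsEhrhartPolynomial P q) : p = q := by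
  refine Polynomial.eq_of_infinite_eval_eq p q ?_
  refine Set.Infinite.mono ?_ ((Set.Ioi_infinite 0).image (Nat.cast_injective (R := ℝ)).injOn)
  rintro _ ⟨t, ht, rfl⟩
  exact (hp t ht).trans (hq t ht).symm

theorem luckyCount_eq {n : ℕ} (y : Fin n → ℕ) (l : Option (Fin n)) (j : ℕ) :
    luckyCount y l j =
      ((parkingFunctions y).filter fun σ => (luckyCars y l σ).card = j).card := by
  rw [luckyCount, ← Set.ncard_coe_finset]
  congr 1
  ext σ
  simp [mem_parkingFunctions]

theorem card_luckyCars_lt {n : ℕ} (y : Fin n → ℕ) (l : Option (Fin n)) (σ : Fin n → ℕ) :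
    (luckyCars y l σ).card < n + 1 :=
  Nat.lt_succ_of_le ((Finset.card_le_univ _).trans_eq (Fintype.card_fin n))

theorem sum_luckyCount_mul {n : ℕ} (y : Fin n → ℕ) (l : Option (Fin n)) (f : ℕ → ℝ) :
    ∑ j : Fin (n + 1), (luckyCount y l j : ℝ) * f j =
      ∑ σ ∈ parkingFunctions y, f (luckyCars y l σ).card := by
  rw [Fin.sum_univ_eq_sum_range fun j => (luckyCount y l j : ℝ) * f j,
    ← Finset.sum_fiberwise_of_maps_to (t := Finset.range (n + 1))
      (g := fun σ => (luckyCars y l σ).card)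
      fun σ _ => Finset.mem_range.2 (card_luckyCars_lt y l σ)]
  refine Finset.sum_congr rfl fun j _ => ?_
  rw [luckyCount_eq, ← nsmul_eq_mul, ← Finset.sum_const]
  exact Finset.sum_congr rfl fun σ hσ => by rw [(Finset.mem_filter.1 hσ).2]

/-- The polynomial whose magic coefficients are the numbers of parking functions by lucky cars,
divided by `n!`. -/
noncomputable def luckyPolynomial {n : ℕ} (y : Fin n → ℕ) (l : Option (Fin n)) : ℝ[X] :=
  ∑ j : Fin (n + 1), Polynomial.C ((luckyCount y l j : ℝ) / n !) *
    (Polynomial.X ^ (j : ℕ) * (1 + Polynomial.X) ^ (n - (j : ℕ)))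

theorem isEhrhartPolynomial_luckyPolynomial {n : ℕ} (hn : 0 < n) (y : Fin n → ℕ)
    (hy : ∀ i, n - 1 ≤ y i) (hy1 : n ≤ y ⟨0, hn⟩) :
    IsEhrhartPolynomial (polytope y) (luckyPolynomial y (some ⟨0, hn⟩)) := by
  intro t ht
  have hfac : (n ! : ℝ) ≠ 0 := by exact_mod_cast n.factorial_ne_zero
  have h := congrArg (Nat.cast : ℕ → ℝ) (sum_parkingFunctions_lucky hn y hy hy1 t)
  push_cast at h
  rw [← sum_luckyCount_mul y (some ⟨0, hn⟩) fun j => (t : ℝ) ^ j * (1 + t) ^ (n - j)] at h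
  rw [smul_polytope y ht, latticePointCount_polytope, eq_comm, ← mul_right_inj' hfac, ← h,
    luckyPolynomial, Polynomial.eval_finsetSum, Finset.mul_sum]
  refine Finset.sum_congr rfl fun j _ => ?_
  simp only [Polynomial.eval_mul, Polynomial.eval_C, Polynomial.eval_pow, Polynomial.eval_X,
    Polynomial.eval_add, Polynomial.eval_one]
  field_simp

theorem parkingFunctions_nonempty {n : ℕ} (hn : 0 < n) (y : Fin n → ℕ) (hy : 0 < y ⟨0, hn⟩) :
    (parkingFunctions y).Nonempty := by
  refine ⟨fun _ => 1, (mem_parkingFunctions _ _).2 ⟨fun _ => one_pos, fun i => ?_⟩⟩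
  refine (Nat.succ_le_of_lt hy).trans ?_
  exact Finset.single_le_sum (f := y) (fun _ _ => Nat.zero_le _)
    (Finset.mem_Iic.2 (Fin.mk_le_of_le_val (Nat.zero_le _)))

end PitmanStanley

theorem mainTheorem5 (n : ℕ) (hn : 0 < n) (y : Fin n → ℕ)
    (hy : ∀ i, n - 1 ≤ y i) (hy1 : n ≤ y ⟨0, hn⟩) :
    (∃! p : ℝ[X], PitmanStanley.IsEhrhartPolynomial (PitmanStanley.polytope y) p) ∧
    ∀ p : ℝ[X], PitmanStanley.IsEhrhartPolynomial (PitmanStanley.polytope y) p →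
      p.natDegree = n ∧
      (∃! c : Fin (n + 1) → ℝ, PitmanStanley.IsMagicExpansion n p c) ∧
      ∀ c : Fin (n + 1) → ℝ, PitmanStanley.IsMagicExpansion n p c →
        ∀ j : Fin (n + 1),
          (n ! : ℝ) * c j = (PitmanStanley.luckyCount y (some ⟨0, hn⟩) j : ℝ) := by
  have hE := PitmanStanley.isEhrhartPolynomial_luckyPolynomial hn y hy hy1
  have hfac : (n ! : ℝ) ≠ 0 := by exact_mod_cast n.factorial_ne_zero
  refine ⟨⟨_, hE, fun q hq => hq.unique hE⟩, fun p hp => ?_⟩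
  obtain rfl := hp.unique hE
  set c₀ : Fin (n + 1) → ℝ := fun j => (PitmanStanley.luckyCount y (some ⟨0, hn⟩) j : ℝ) / n !
    with hc₀
  have hM : PitmanStanley.IsMagicExpansion n
      (PitmanStanley.luckyPolynomial y (some ⟨0, hn⟩)) c₀ := rfl
  refine ⟨PitmanStanley.natDegree_of_isMagicExpansion hM ?_,
    ⟨c₀, hM, fun c hc => PitmanStanley.eq_of_isMagicExpansion hc hM⟩, fun c hc j => ?_⟩
  -- The coefficients sum to the number of parking functions over `n!`, which is nonzero because the
  -- constant sequence `1` is a parking function.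
  · have h := PitmanStanley.sum_luckyCount_mul y (some ⟨0, hn⟩) fun _ => 1
    simp only [mul_one, Finset.sum_const, nsmul_eq_mul] at h
    rw [hc₀, ← Finset.sum_div, h]
    refine div_ne_zero (Nat.cast_ne_zero.2 (Finset.card_ne_zero.2 ?_)) hfac
    exact PitmanStanley.parkingFunctions_nonempty hn y (hn.trans_le hy1)
  · rw [PitmanStanley.eq_of_isMagicExpansion hc hM]
    exact mul_div_cancel₀ _ hfac
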